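/- Let $n\ge 1$ and let $M^{2n+1}$ be a smooth manifold with a $K$-contact structure $(\varphi,\xi,\eta,g)$: $g$ is a Riemannian metric, $\varphi$ a smooth $(1,1)$-tensor field, $\xi$ a smooth unit vector field and $\eta$ a smooth $1$-form with $$\varphi^2=-I+\eta\otimes\xi,\qquad \eta=g(\cdot,\xi),\qquad d\eta(X,Y)=g(X,\varphi Y),$$ where $2\,d\eta(X,Y)=X(\eta(Y))-Y(\eta(X))-\eta([X,Y])$, and $\xi$ is a Killing field ($\mathcal L_\xi g=0$). Let $0<m\le\infty$ and $\rho\in\mathbb R$, and suppose that $(M,g)$ admits an $(m,\rho)$-quasi-Einstein structure with potential $V$, i.e. $V$ is a smooth vector field such that for some $\lambda\in\mathbb R$ $$\tfrac12\,\mathcal L_V g+\mathrm{Ric}-\tfrac1m\,V^\flat\otimes V^\flat=(\lambda+\rho\,r)\,g,$$ where $r$ is the scalar curvature of $g$ and $1/\infty=0$. Suppose that $V$ is collinear to $\xi$, i.e. $V=\sigma\,\xi$ for a smooth function $\sigma$ on $M$. Then $V$ is a Killing field, $M$ is $\eta$-Einstein (that is, $\mathrm{Ric}=a\,g+b\,\eta\otimes\eta$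 for some smooth functions $a,b$ on $M$), and $\sigma$ is locally constant; in particular $\sigma$ is constant if $M$ is connected. -/

import Mathlib

open Bundle FiberBundle VectorField
open scoped Manifold ContDiff ENNReal

noncomputable section

namespace QuasiEinstein

/-! Throughout, `M` is a manifold with model `I`, whose tangent bundle carries a smooth Riemannian
metric `g`, written `inner ℝ`. A vector field is a section `X : Π x : M, TangentSpace I x`.
Identities between tensor fields are tested on all vector fields that are differentiable at the
point considered, so that no global extension of locally defined fields is needed. -/

variable {E : Type*} [NormedAddCommGroup E] [NormedSpace ℝ E]
  {H : Type*} [TopologicalSpace H] {I : ModelWithCorners ℝ E H}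
  {M : Type*} [TopologicalSpace M] [ChartedSpace H M] [IsManifold I ∞ M]
  [RiemannianBundle (fun x : M ↦ TangentSpace I x)]
  [IsContMDiffRiemannianBundle I ∞ E (fun x : M ↦ TangentSpace I x)]

/-- Half of the right-hand side of the Koszul formula, i.e. the value `g(∇_X Y, Z)` at `x`. -/
def koszul (X Y Z : Π x : M, TangentSpace I x) (x : M) : ℝ :=
  (1 / 2 : ℝ) *
    (d% (fun y ↦ inner ℝ (Y y) (Z y)) x (X x)
      + d% (fun y ↦ inner ℝ (Z y) (X y)) x (Y x)
      - d% (fun y ↦ inner ℝ (X y) (Y y)) x (Z x)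
      + inner ℝ (mlieBracket I X Y x) (Z x)
      - inner ℝ (mlieBracket I X Z x) (Y x)
      - inner ℝ (mlieBracket I Y Z x) (X x))

theorem mdifferentiableAt_inner {X Y : Π x : M, TangentSpace I x} {x : M}
    (hX : MDiffAt (T% X) x) (hY : MDiffAt (T% Y) x) :
    MDiffAt (fun y ↦ (inner ℝ (X y) (Y y) : ℝ)) x :=
  MDifferentiableAt.inner_bundle (F := E) (E := fun x : M ↦ TangentSpace I x)
    (b := fun x : M ↦ x) (v := X) (w := Y) hX hY

variable [FiniteDimensional ℝ E]

instance (x : M) : FiniteDimensional ℝ (TangentSpace I x) :=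
  inferInstanceAs (FiniteDimensional ℝ E)

theorem tensorialAt_koszul_left {Y Z : Π x : M, TangentSpace I x} {x : M}
    (hY : MDiffAt (T% Y) x) (hZ : MDiffAt (T% Z) x) :
    TensorialAt I E (fun X ↦ koszul X Y Z x) x where
  smul {f X} hf hX := by
    have h1 : (fun y ↦ inner ℝ (Z y) ((f • X) y)) = fun y ↦ f y * inner ℝ (Z y) (X y) := by
      funext y; simp [inner_smul_right]
    have h2 : (fun y ↦ inner ℝ ((f • X) y) (Y y)) = fun y ↦ f y * inner ℝ (X y) (Y y) := by
      funext y; simp [inner_smul_left]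
    simp only [koszul, h1, h2, mlieBracket_smul_left hf hX,
      mvfderiv_fun_mul hf (mdifferentiableAt_inner hZ hX), mvfderiv_fun_mul hf (mdifferentiableAt_inner hX hY)]
    simp [inner_add_left, inner_smul_left, inner_smul_right, real_inner_comm]
    ring
  add {X X'} hX hX' := by
    simp only [koszul, mlieBracket_add_left hX hX', Pi.add_apply, inner_add_left, inner_add_right,
      mvfderiv_fun_add (mdifferentiableAt_inner hZ hX) (mdifferentiableAt_inner hZ hX'),
      mvfderiv_fun_add (mdifferentiableAt_inner hX hY) (mdifferentiableAt_inner hX' hY)]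
    simp
    ring

theorem tensorialAt_koszul_right {X Y : Π x : M, TangentSpace I x} {x : M}
    (hX : MDiffAt (T% X) x) (hY : MDiffAt (T% Y) x) :
    TensorialAt I E (fun Z ↦ koszul X Y Z x) x where
  smul {f Z} hf hZ := by
    have h1 : (fun y ↦ inner ℝ (Y y) ((f • Z) y)) = fun y ↦ f y * inner ℝ (Y y) (Z y) := by
      funext y; simp [inner_smul_right]
    have h2 : (fun y ↦ inner ℝ ((f • Z) y) (X y)) = fun y ↦ f y * inner ℝ (Z y) (X y) := by
      funext y; simp [inner_smul_left]
    simp only [koszul, h1, h2, mlieBracket_smul_right hf hZ,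
      mvfderiv_fun_mul hf (mdifferentiableAt_inner hY hZ), mvfderiv_fun_mul hf (mdifferentiableAt_inner hZ hX)]
    simp [inner_add_left, inner_smul_left, inner_smul_right, real_inner_comm]
    ring
  add {Z Z'} hZ hZ' := by
    simp only [koszul, mlieBracket_add_right hZ hZ', Pi.add_apply, inner_add_left, inner_add_right,
      mvfderiv_fun_add (mdifferentiableAt_inner hY hZ) (mdifferentiableAt_inner hY hZ'),
      mvfderiv_fun_add (mdifferentiableAt_inner hZ hX) (mdifferentiableAt_inner hZ' hX)]
    simp
    ring

open Classical in
/-- The covariant 2-tensor `(u, w) ↦ g(∇_u Y, w)` at `x`, for a vector field `Y` which is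
differentiable at `x` (and the junk value `0` if it is not). -/
def koszulForm (Y : Π x : M, TangentSpace I x) (x : M) :
    TangentSpace I x →L[ℝ] TangentSpace I x →L[ℝ] ℝ :=
  if hY : MDiffAt (T% Y) x then
    TensorialAt.mkHom₂ (fun X Z ↦ koszul X Y Z x) x
      (fun _ hZ ↦ tensorialAt_koszul_left hY hZ) (fun _ hX ↦ tensorialAt_koszul_right hX hY)
  else 0

theorem koszulForm_apply {X Y Z : Π x : M, TangentSpace I x} {x : M}
    (hX : MDiffAt (T% X) x) (hY : MDiffAt (T% Y) x) (hZ : MDiffAt (T% Z) x) :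
    koszulForm Y x (X x) (Z x) = koszul X Y Z x := by
  rw [koszulForm, dif_pos hY, TensorialAt.mkHom₂_apply _ _ hX hZ]

theorem koszulForm_add {Y Y' : Π x : M, TangentSpace I x} {x : M}
    (hY : MDiffAt (T% Y) x) (hY' : MDiffAt (T% Y') x) :
    koszulForm (Y + Y') x = koszulForm Y x + koszulForm Y' x := by
  ext u w
  have hU := mdifferentiableAt_extend I E (V := fun x : M ↦ TangentSpace I x) u
  have hW := mdifferentiableAt_extend I E (V := fun x : M ↦ TangentSpace I x) w
  have key : koszul (extend E u) (Y + Y') (extend E w) x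
      = koszul (extend E u) Y (extend E w) x + koszul (extend E u) Y' (extend E w) x := by
    simp only [koszul, mlieBracket_add_right hY hY', mlieBracket_add_left hY hY', Pi.add_apply,
      inner_add_left, inner_add_right,
      mvfderiv_fun_add (mdifferentiableAt_inner hY hW) (mdifferentiableAt_inner hY' hW),
      mvfderiv_fun_add (mdifferentiableAt_inner hU hY) (mdifferentiableAt_inner hU hY')]
    simp
    ring
  rw [← koszulForm_apply hU (mdifferentiableAt_add_section hY hY') hW,
    ← koszulForm_apply hU hY hW, ← koszulForm_apply hU hY' hW] at key
  simpa using key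

theorem koszulForm_smul {f : M → ℝ} {Y : Π x : M, TangentSpace I x} {x : M}
    (hf : MDiffAt f x) (hY : MDiffAt (T% Y) x) (u w : TangentSpace I x) :
    koszulForm (f • Y) x u w = f x * koszulForm Y x u w + d% f x u * inner ℝ (Y x) w := by
  have hU := mdifferentiableAt_extend I E (V := fun x : M ↦ TangentSpace I x) u
  have hW := mdifferentiableAt_extend I E (V := fun x : M ↦ TangentSpace I x) w
  have h1 (Z : Π x : M, TangentSpace I x) :
      (fun y ↦ (inner ℝ ((f • Y) y) (Z y) : ℝ)) = fun y ↦ f y * inner ℝ (Y y) (Z y) := by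
    funext y; simp [inner_smul_left]
  have h2 (Z : Π x : M, TangentSpace I x) :
      (fun y ↦ (inner ℝ (Z y) ((f • Y) y) : ℝ)) = fun y ↦ f y * inner ℝ (Z y) (Y y) := by
    funext y; simp [inner_smul_right]
  have key : koszul (extend E u) (f • Y) (extend E w) x
      = f x * koszul (extend E u) Y (extend E w) x
        + d% f x (extend E u x) * inner ℝ (Y x) (extend E w x) := by
    simp only [koszul, h1, h2, mlieBracket_smul_left hf hY, mlieBracket_smul_right hf hY,
      mvfderiv_fun_mul hf (mdifferentiableAt_inner hY hW),
      mvfderiv_fun_mul hf (mdifferentiableAt_inner hU hY)]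
    simp [inner_add_left, inner_smul_left, inner_smul_right, real_inner_comm]
    ring
  rw [← koszulForm_apply hU (hf.smul_section hY) hW, ← koszulForm_apply hU hY hW] at key
  simpa using key

/-- The vector `∇_u Y` at `x`: the one that represents `w ↦ koszulForm Y x u w` with respect to
the metric, written in an orthonormal basis. -/
def nabla (Y : Π x : M, TangentSpace I x) (x : M) : TangentSpace I x →L[ℝ] TangentSpace I x :=
  ∑ i, ((koszulForm Y x).flip (stdOrthonormalBasis ℝ (TangentSpace I x) i)).smulRight
    (stdOrthonormalBasis ℝ (TangentSpace I x) i)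

theorem inner_nabla (Y : Π x : M, TangentSpace I x) (x : M) (u w : TangentSpace I x) :
    inner ℝ (nabla Y x u) w = koszulForm Y x u w := by
  conv_rhs => rw [← (stdOrthonormalBasis ℝ (TangentSpace I x)).sum_repr' w]
  simp [nabla, sum_inner, inner_smul_left, mul_comm]

variable (I M) in
/-- The Levi-Civita connection of the Riemannian metric, given by the Koszul formula. As always in
Mathlib, `leviCivita I M Y x (X x)` is `∇_X Y` at `x`. -/
def leviCivita : CovariantDerivative I E (fun x : M ↦ TangentSpace I x) where
  toFun := nabla
  isCovariantDerivativeOnUniv :=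
    { add := fun {Y Y' x} hY hY' _ ↦ by
        ext1 u
        refine ext_inner_right ℝ fun w ↦ ?_
        simp [inner_nabla, inner_add_left, koszulForm_add hY hY']
      leibniz := fun {Y f x} hY hf _ ↦ by
        ext1 u
        refine ext_inner_right ℝ fun w ↦ ?_
        simp [inner_nabla, inner_add_left, inner_smul_left, koszulForm_smul hf hY] }

theorem inner_leviCivita {X Y Z : Π x : M, TangentSpace I x} {x : M}
    (hX : MDiffAt (T% X) x) (hY : MDiffAt (T% Y) x) (hZ : MDiffAt (T% Z) x) :
    inner ℝ (leviCivita I M Y x (X x)) (Z x) = koszul X Y Z x :=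
  (inner_nabla Y x (X x) (Z x)).trans (koszulForm_apply hX hY hZ)

theorem leviCivita_torsion : (leviCivita I M).torsion = 0 := by
  refine (leviCivita I M).torsion_eq_zero_iff.2 fun {X Y x} hX hY ↦ ?_
  refine ext_inner_right ℝ fun w ↦ ?_
  have hW := mdifferentiableAt_extend I E (V := fun x : M ↦ TangentSpace I x) w
  have h1 := inner_leviCivita hX hY hW
  have h2 := inner_leviCivita hY hX hW
  simp only [extend_apply_self] at h1 h2
  rw [inner_sub_left, h1, h2]
  simp only [koszul, mlieBracket_swap_apply (V := Y) (W := X), real_inner_comm, extend_apply_self]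
  simp
  ring

theorem leviCivita_metric {X Y Z : Π x : M, TangentSpace I x} {x : M}
    (hX : MDiffAt (T% X) x) (hY : MDiffAt (T% Y) x) (hZ : MDiffAt (T% Z) x) :
    d% (fun y ↦ (inner ℝ (Y y) (Z y) : ℝ)) x (X x)
      = inner ℝ (leviCivita I M Y x (X x)) (Z x) + inner ℝ (Y x) (leviCivita I M Z x (X x)) := by
  rw [real_inner_comm (leviCivita I M Z x (X x)) (Y x), inner_leviCivita hX hY hZ,
    inner_leviCivita hX hZ hY]
  simp only [koszul, mlieBracket_swap_apply (V := Z) (W := Y), real_inner_comm]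
  simp
  ring

/-! ### Curvature -/

/-- The curvature `R(X, Y)Z = ∇_X ∇_Y Z - ∇_Y ∇_X Z - ∇_[X, Y] Z` at `x`. -/
def curvature (X Y Z : Π x : M, TangentSpace I x) (x : M) : TangentSpace I x :=
  leviCivita I M (fun y ↦ leviCivita I M Z y (Y y)) x (X x)
    - leviCivita I M (fun y ↦ leviCivita I M Z y (X y)) x (Y x)
    - leviCivita I M Z x (mlieBracket I X Y x)

/-- The curvature tensor `R(u, v)w` on tangent vectors at `x`. The vectors are extended to vector
fields that are smooth near `x`; the value does not depend on the extensions because `curvature`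
is tensorial. -/
def curvatureTensor (x : M) (u v w : TangentSpace I x) : TangentSpace I x :=
  curvature (extend E u) (extend E v) (extend E w) x

/-- The Ricci tensor `Ric(v, w) = tr (u ↦ R(u, v)w) = ∑ i, g(R(eᵢ, v)w, eᵢ)`, where `(eᵢ)` is an
orthonormal basis of the tangent space. -/
def ricci (x : M) (v w : TangentSpace I x) : ℝ :=
  ∑ i, inner ℝ (curvatureTensor x (stdOrthonormalBasis ℝ (TangentSpace I x) i) v w)
    (stdOrthonormalBasis ℝ (TangentSpace I x) i)

variable (I) in
/-- The scalar curvature, i.e. the trace `∑ i, Ric(eᵢ, eᵢ)` of the Ricci tensor. -/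
def scalarCurvature (x : M) : ℝ :=
  ∑ i, ricci x (stdOrthonormalBasis ℝ (TangentSpace I x) i)
    (stdOrthonormalBasis ℝ (TangentSpace I x) i)

/-! ### Killing fields, contact metric structures and quasi-Einstein structures -/

/-- The Lie derivative of the metric,
`(𝓛_V g)(X, Y) = V g(X, Y) - g([V, X], Y) - g(X, [V, Y])`, at `x`. -/
def lieDerivMetric (V X Y : Π x : M, TangentSpace I x) (x : M) : ℝ :=
  d% (fun y ↦ (inner ℝ (X y) (Y y) : ℝ)) x (V x)
    - inner ℝ (mlieBracket I V X x) (Y x) - inner ℝ (X x) (mlieBracket I V Y x)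

/-- A smooth vector field `V` is a Killing field if `𝓛_V g = 0`. -/
structure IsKilling (V : Π x : M, TangentSpace I x) : Prop where
  smooth : CMDiff ∞ (T% V)
  lieDerivMetric_eq_zero : ∀ (x : M) (X Y : Π x : M, TangentSpace I x),
    MDiffAt (T% X) x → MDiffAt (T% Y) x → lieDerivMetric V X Y x = 0

/-- The exterior derivative of a 1-form, with the convention
`2 dη(X, Y) = X(η(Y)) - Y(η(X)) - η([X, Y])` which is usual in contact metric geometry. -/
def dOneForm (η : Π x : M, TangentSpace I x →L[ℝ] ℝ) (X Y : Π x : M, TangentSpace I x)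
    (x : M) : ℝ :=
  (1 / 2 : ℝ) * (d% (fun y ↦ η y (Y y)) x (X x) - d% (fun y ↦ η y (X y)) x (Y x)
    - η x (mlieBracket I X Y x))

/-- `(φ, ξ, η, g)` is a contact metric structure on `M`: `φ` is a smooth `(1,1)`-tensor field, `ξ` a
smooth unit vector field, `η` a smooth 1-form, with `φ² = -I + η ⊗ ξ`, `η = g(·, ξ)` and
`dη(X, Y) = g(X, φ Y)`. -/
structure IsContactMetric (φ : Π x : M, TangentSpace I x →L[ℝ] TangentSpace I x)
    (ξ : Π x : M, TangentSpace I x) (η : Π x : M, TangentSpace I x →L[ℝ] ℝ) : Prop where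
  smooth_phi : ContMDiff I (I.prod 𝓘(ℝ, E →L[ℝ] E)) ∞
    (fun x ↦ TotalSpace.mk' (E →L[ℝ] E)
      (E := fun x : M ↦ TangentSpace I x →L[ℝ] TangentSpace I x) x (φ x))
  smooth_xi : CMDiff ∞ (T% ξ)
  smooth_eta : ContMDiff I (I.prod 𝓘(ℝ, E →L[ℝ] ℝ)) ∞
    (fun x ↦ TotalSpace.mk' (E →L[ℝ] ℝ)
      (E := fun x : M ↦ TangentSpace I x →L[ℝ] ℝ) x (η x))
  inner_xi : ∀ x : M, (inner ℝ (ξ x) (ξ x) : ℝ) = 1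
  phi_phi : ∀ (x : M) (v : TangentSpace I x), φ x (φ x v) = -v + η x v • ξ x
  eta_eq : ∀ (x : M) (v : TangentSpace I x), η x v = inner ℝ v (ξ x)
  d_eta : ∀ (x : M) (X Y : Π x : M, TangentSpace I x), MDiffAt (T% X) x → MDiffAt (T% Y) x →
    dOneForm η X Y x = inner ℝ (X x) (φ x (Y x))

/-- A `K`-contact structure is a contact metric structure whose Reeb field `ξ` is Killing. -/
structure IsKContact (φ : Π x : M, TangentSpace I x →L[ℝ] TangentSpace I x)
    (ξ : Π x : M, TangentSpace I x) (η : Π x : M, TangentSpace I x →L[ℝ] ℝ) : Prop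
    extends IsContactMetric φ ξ η where
  killing : IsKilling ξ

/-- `V` is the potential of an `(m, ρ)`-quasi-Einstein structure, `0 < m ≤ ∞`: for some real `lam`,
`½ 𝓛_V g + Ric - (1/m) V♭ ⊗ V♭ = (lam + ρ r) g`, where `r` is the scalar curvature.
For `m = ∞` the coefficient `1/m` is `0`. -/
structure IsQuasiEinstein (m : ℝ≥0∞) (ρ : ℝ) (V : Π x : M, TangentSpace I x) : Prop where
  pos : 0 < m
  smooth : CMDiff ∞ (T% V)
  equation : ∃ lam : ℝ, ∀ (x : M) (X Y : Π x : M, TangentSpace I x),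
    MDiffAt (T% X) x → MDiffAt (T% Y) x →
    (1 / 2 : ℝ) * lieDerivMetric V X Y x + ricci x (X x) (Y x)
        - (m⁻¹).toReal * (inner ℝ (V x) (X x) * inner ℝ (V x) (Y x))
      = (lam + ρ * scalarCurvature I x) * inner ℝ (X x) (Y x)

/-- `M` is `η`-Einstein: `Ric = a g + b η ⊗ η` for smooth functions `a`, `b` on `M`. -/
def IsEtaEinstein (η : Π x : M, TangentSpace I x →L[ℝ] ℝ) : Prop :=
  ∃ a b : M → ℝ, CMDiff ∞ a ∧ CMDiff ∞ b ∧ ∀ (x : M) (v w : TangentSpace I x),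
    ricci x v w = a x * inner ℝ v w + b x * (η x v * η x w)

end QuasiEinstein

end

set_option linter.unusedSectionVars false

/-! Since `ξ` is Killing, `𝓛_{σξ} g = dσ ⊗ η + η ⊗ dσ`, and every `K`-contact manifold satisfies
`Ric(·, ξ) = (dim M - 1) η`. Putting `ξ` in one slot of the quasi-Einstein equation therefore leaves
only multiples of `η` next to `dσ`, so `dσ = (ξσ) η`. Now `d(dσ) = 0` is evaluated on `u` and `φu`
with `u ≠ 0` orthogonal to `ξ`: what survives is `(ξσ) dη(u, φu) = -(ξσ)|u|²`. Hence `ξσ = 0` and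
`dσ = 0`. Then `𝓛_V g = 0`, and the equation itself expresses `Ric` through `g` and `η ⊗ η`.

The main work is the Ricci identity (`ricci_xi`). From `∇ξ = -φ` (`leviCivita_xi`), the curvature
`R(·, ·)ξ` is an antisymmetrization of `∇φ`, and tracing it gives the divergence of `φ`. That
divergence is computed by linear algebra in one tangent space (`sum_inner_covDeriv_self`) from the
skewness of `∇φ`, the derivative of `φ² = -I + η ⊗ ξ`, and the cyclic identity for `∇φ`, which comes
from the first Bianchi identity. The vanishing of `dσ` is `mvfderiv_eq_zero_of_collinear`. -/

namespace QuasiEinstein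

open Filter
open scoped Topology

/-! ### Smoothness of brackets, inner products and directional derivatives. -/

section Smoothness

variable {E : Type*} [NormedAddCommGroup E] [NormedSpace ℝ E]
  {H : Type*} [TopologicalSpace H] {I : ModelWithCorners ℝ E H}
  {M : Type*} [TopologicalSpace M] [ChartedSpace H M] [IsManifold I ∞ M]

theorem eventually_mdifferentiableAt_section {X : Π x : M, TangentSpace I x} {x : M}
    (hX : CMDiffAt ∞ (T% X) x) : ∀ᶠ y in 𝓝 x, MDiffAt (T% X) y := by
  have h : CMDiffAt 1 (T% X) x := hX.of_le (by exact_mod_cast le_top)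
  filter_upwards [contMDiffAt_iff_contMDiffAt_nhds (by simp) |>.1 h] with y hy
  exact hy.mdifferentiableAt one_ne_zero

theorem mdifferentiableAt_section {X : Π x : M, TangentSpace I x} {x : M}
    (hX : CMDiffAt ∞ (T% X) x) : MDiffAt (T% X) x :=
  hX.mdifferentiableAt (by simp)

theorem eventually_mdifferentiableAt {f : M → ℝ} {x : M}
    (hf : CMDiffAt ∞ f x) : ∀ᶠ y in 𝓝 x, MDiffAt f y := by
  have h : CMDiffAt 1 f x := hf.of_le (by exact_mod_cast le_top)
  filter_upwards [contMDiffAt_iff_contMDiffAt_nhds (by simp) |>.1 h] with y hy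
  exact hy.mdifferentiableAt one_ne_zero

theorem mvfderiv_congr {f g : M → ℝ} {x : M} (h : f =ᶠ[𝓝 x] g) :
    (d% f x : TangentSpace I x →L[ℝ] ℝ) = d% g x := by
  ext v
  simp only [mvfderiv, h.mfderiv_eq]
  rfl

variable [CompleteSpace E]

theorem contMDiffAt_mlieBracket {X Y : Π x : M, TangentSpace I x} {x : M}
    (hX : CMDiffAt ∞ (T% X) x) (hY : CMDiffAt ∞ (T% Y) x) :
    CMDiffAt ∞ (T% (mlieBracket I X Y)) x := by
  have : IsManifold I (minSmoothness ℝ 2) M := by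
    simp only [minSmoothness_of_isRCLikeNormedField]; infer_instance
  have : IsManifold I ((⊤ : ℕ∞) + 1) M := inferInstanceAs (IsManifold I ∞ M)
  exact ContMDiffAt.mlieBracket_vectorField (m := ⊤) (n := ⊤) hX hY (by simp)

theorem jacobi_mlieBracket {X Y Z : Π x : M, TangentSpace I x} {x : M}
    (hX : CMDiffAt ∞ (T% X) x) (hY : CMDiffAt ∞ (T% Y) x) (hZ : CMDiffAt ∞ (T% Z) x) :
    mlieBracket I X (mlieBracket I Y Z) x =
      mlieBracket I (mlieBracket I X Y) Z x + mlieBracket I Y (mlieBracket I X Z) x := by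
  have : IsManifold I (minSmoothness ℝ 3) M := by
    simp only [minSmoothness_of_isRCLikeNormedField]; infer_instance
  have h : minSmoothness ℝ 2 ≤ (∞ : ℕ∞ω) := by
    simp only [minSmoothness_of_isRCLikeNormedField]
    exact WithTop.coe_le_coe.2 (le_top : (2 : ℕ∞) ≤ ⊤)
  exact leibniz_identity_mlieBracket_apply (hX.of_le h) (hY.of_le h) (hZ.of_le h)

variable [RiemannianBundle (fun x : M ↦ TangentSpace I x)]
  [IsContMDiffRiemannianBundle I ∞ E (fun x : M ↦ TangentSpace I x)]

theorem contMDiffAt_inner {X Y : Π x : M, TangentSpace I x} {x : M}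
    (hX : CMDiffAt ∞ (T% X) x) (hY : CMDiffAt ∞ (T% Y) x) :
    CMDiffAt ∞ (fun y ↦ (inner ℝ (X y) (Y y) : ℝ)) x :=
  ContMDiffAt.inner_bundle (F := E) (E := fun x : M ↦ TangentSpace I x)
    (b := fun x : M ↦ x) (v := X) (w := Y) hX hY

/-- The bracket `[X, f Z]` isolates the term `(X f) Z`, so that `X f` inherits its smoothness. -/
theorem contMDiffAt_mvfderiv {X : Π x : M, TangentSpace I x} {f : M → ℝ} {x : M}
    (hf : CMDiffAt ∞ f x) (hX : CMDiffAt ∞ (T% X) x) :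
    CMDiffAt ∞ (fun y ↦ d% f y (X y)) x := by
  -- The argument needs a field `Z` with `Z x ≠ 0`, so dimension zero is treated apart.
  by_cases hE : Subsingleton E
  · have : (fun y ↦ d% f y (X y)) = fun _ ↦ (0 : ℝ) := by
      funext y
      have : X y = 0 := Subsingleton.elim (α := E) _ _
      rw [this, map_zero]
    rw [this]
    exact contMDiffAt_const
  rw [not_subsingleton_iff_nontrivial] at hE
  obtain ⟨z, hz⟩ := exists_ne (0 : E)
  let Z : Π y : M, TangentSpace I y := extend E (show TangentSpace I x from z)
  have hZ : CMDiffAt ∞ (T% Z) x := contMDiffAt_extend I E _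
  have hZx : Z x = z := extend_apply_self _ _
  have hne : (inner ℝ (Z x) (Z x) : ℝ) ≠ 0 := by
    rw [hZx]
    exact fun h ↦ hz (inner_self_eq_zero (𝕜 := ℝ) (E := TangentSpace I x).1 h)
  have hZZ := contMDiffAt_inner hZ hZ
  have h1 := contMDiffAt_inner
    ((contMDiffAt_mlieBracket hX (hf.smul_section hZ)).sub_section
      (hf.smul_section (contMDiffAt_mlieBracket hX hZ))) hZ
  have h2 := h1.div₀ hZZ hne
  refine h2.congr_of_eventuallyEq ?_
  filter_upwards [eventually_mdifferentiableAt hf, eventually_mdifferentiableAt_section hZ,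
    hZZ.continuousAt.eventually_ne hne] with y hfy hZy hy
  simp only [Pi.sub_apply, Pi.smul_apply', mlieBracket_smul_right hfy hZy, add_sub_cancel_right,
    Pi.div_apply, inner_smul_left, conj_trivial]
  field_simp

/-- `X (Y f) - Y (X f) = [X, Y] f`, read off from the Jacobi identity for `X`, `Y` and `f Z`. -/
theorem mvfderiv_commutator {X Y : Π x : M, TangentSpace I x} {f : M → ℝ} {x : M}
    (hf : CMDiffAt ∞ f x) (hX : CMDiffAt ∞ (T% X) x) (hY : CMDiffAt ∞ (T% Y) x) :
    d% (fun y ↦ d% f y (Y y)) x (X x) - d% (fun y ↦ d% f y (X y)) x (Y x)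
      = d% f x (mlieBracket I X Y x) := by
  by_cases hE : Subsingleton E
  · have h (u : TangentSpace I x) : u = 0 := Subsingleton.elim (α := E) _ _
    rw [h (X x), h (Y x), h (mlieBracket I X Y x)]
    simp
  rw [not_subsingleton_iff_nontrivial] at hE
  obtain ⟨z, hz⟩ := exists_ne (0 : E)
  let Z : Π y : M, TangentSpace I y := extend E (show TangentSpace I x from z)
  have hZ : CMDiffAt ∞ (T% Z) x := contMDiffAt_extend I E _
  have hZx : Z x ≠ 0 := by
    rw [show Z x = z from extend_apply_self _ _]
    exact hz
  have hfx := hf.mdifferentiableAt (by simp)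
  have expand {X Y : Π x : M, TangentSpace I x} (hX : CMDiffAt ∞ (T% X) x)
      (hY : CMDiffAt ∞ (T% Y) x) : mlieBracket I X (mlieBracket I Y (f • Z)) x
        = d% (fun y ↦ d% f y (Y y)) x (X x) • Z x + d% f x (Y x) • mlieBracket I X Z x
          + (d% f x (X x) • mlieBracket I Y Z x + f x • mlieBracket I X (mlieBracket I Y Z) x) := by
    have hev : mlieBracket I Y (f • Z) =ᶠ[𝓝 x]
        (fun y ↦ d% f y (Y y)) • Z + f • mlieBracket I Y Z := by
      filter_upwards [eventually_mdifferentiableAt hf, eventually_mdifferentiableAt_section hZ]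
        with y hfy hZy
      exact mlieBracket_smul_right hfy hZy
    have hd := contMDiffAt_mvfderiv hf hY
    have hb := contMDiffAt_mlieBracket hY hZ
    rw [EventuallyEq.rfl.mlieBracket_vectorField_eq hev,
      mlieBracket_add_right (mdifferentiableAt_section (hd.smul_section hZ))
        (mdifferentiableAt_section (hf.smul_section hb)),
      mlieBracket_smul_right (hd.mdifferentiableAt (by simp)) (mdifferentiableAt_section hZ),
      mlieBracket_smul_right hfx (mdifferentiableAt_section hb)]
  -- After expansion, the terms with first derivatives of `f` cancel, the terms in `f` cancel by
  -- Jacobi for `X`, `Y`, `Z`, and a multiple of `Z x ≠ 0` remains.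
  have hJ := jacobi_mlieBracket hX hY (hf.smul_section hZ)
  rw [expand hX hY, expand hY hX, mlieBracket_smul_right hfx (mdifferentiableAt_section hZ),
    jacobi_mlieBracket hX hY hZ] at hJ
  refine smul_left_injective ℝ hZx ?_
  simp only [sub_smul]
  rw [← sub_eq_zero] at hJ ⊢
  rw [← hJ]
  module

end Smoothness

theorem contMDiffAt_det {E : Type*} [NormedAddCommGroup E] [NormedSpace ℝ E]
    {H : Type*} [TopologicalSpace H] {I : ModelWithCorners ℝ E H}
    {M : Type*} [TopologicalSpace M] [ChartedSpace H M] {ι : Type*} [Fintype ι] [DecidableEq ι]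
    {A : M → Matrix ι ι ℝ} {x : M} (hA : ∀ i j, CMDiffAt ∞ (fun y ↦ A y i j) x) :
    CMDiffAt ∞ (fun y ↦ (A y).det) x := by
  simp only [Matrix.det_apply']
  refine ContMDiffAt.sum fun s _ ↦ ?_
  exact contMDiffAt_const.mul (contMDiffAt_finsetProd fun i _ ↦ hA _ _)

/-! ### The Levi-Civita connection and the symmetries of its curvature. -/

section Connection

variable {E : Type*} [NormedAddCommGroup E] [NormedSpace ℝ E] [FiniteDimensional ℝ E]
  {H : Type*} [TopologicalSpace H] {I : ModelWithCorners ℝ E H}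
  {M : Type*} [TopologicalSpace M] [ChartedSpace H M] [IsManifold I ∞ M]
  [RiemannianBundle (fun x : M ↦ TangentSpace I x)]
  [IsContMDiffRiemannianBundle I ∞ E (fun x : M ↦ TangentSpace I x)]

/-- A vector field is smooth if its inner products with smooth vector fields are: solve for its
components in a local frame by Cramer's rule for the Gram matrix. -/
theorem contMDiffAt_of_inner {P : Π x : M, TangentSpace I x} {x : M}
    (h : ∀ W : Π x : M, TangentSpace I x, CMDiffAt ∞ (T% W) x →
      CMDiffAt ∞ (fun y ↦ (inner ℝ (P y) (W y) : ℝ)) x) :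
    CMDiffAt ∞ (T% P) x := by
  let b := stdOrthonormalBasis ℝ (TangentSpace I x)
  let s (i) : Π y : M, TangentSpace I y := extend E (b i)
  have hs (i) : CMDiffAt ∞ (T% (s i)) x := contMDiffAt_extend I E _
  let G (y : M) : Matrix _ _ ℝ := Matrix.of fun j i ↦ (inner ℝ (s i y) (s j y) : ℝ)
  let k (y : M) (j) : ℝ := inner ℝ (P y) (s j y)
  have hG (j i) : CMDiffAt ∞ (fun y ↦ G y j i) x := contMDiffAt_inner (hs i) (hs j)
  have hdet : CMDiffAt ∞ (fun y ↦ (G y).det) x := contMDiffAt_det hG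
  have hne : (G x).det ≠ 0 := by
    -- The frame is orthonormal at `x` only; invertibility of its Gram matrix persists nearby by
    -- continuity.
    have : G x = 1 := by
      ext j i
      simp [G, s, orthonormal_iff_ite.1 b.orthonormal, Matrix.one_apply, eq_comm]
    simp [this]
  let c (i) (y : M) : ℝ := (G y).cramer (k y) i / (G y).det
  have hc (i) : CMDiffAt ∞ (c i) x := by
    refine ContMDiffAt.div₀ ?_ hdet hne
    simp only [Matrix.cramer_apply]
    refine contMDiffAt_det fun j l ↦ ?_
    by_cases hl : l = i
    · simpa [Matrix.updateCol_apply, hl] using! h _ (hs j)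
    · simpa [Matrix.updateCol_apply, hl] using hG j l
  have hsum : CMDiffAt ∞ (T% (fun y ↦ ∑ i, (c i • s i) y)) x :=
    ContMDiffAt.sum_section fun i _ ↦ (hc i).smul_section (hs i)
  refine hsum.congr_of_eventuallyEq ?_
  filter_upwards [hdet.continuousAt.eventually_ne hne] with y hy
  have hli : LinearIndependent ℝ (fun i ↦ s i y) := by
    refine Fintype.linearIndependent_iff.2 fun g hg ↦ ?_
    have h0 : (G y).mulVec g = 0 := by
      ext j
      have := congrArg (fun v ↦ (inner ℝ v (s j y) : ℝ)) hg
      simpa [sum_inner, inner_smul_left, Matrix.mulVec, dotProduct, G, mul_comm] using this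
    exact congrFun (Matrix.eq_zero_of_mulVec_eq_zero hy h0)
  have hspan := hli.span_eq_top_of_card_eq_finrank' (by
    rw [Fintype.card_fin]; rfl)
  congr 1
  refine InnerProductSpace.ext_inner_right_basis (𝕜 := ℝ) (Module.Basis.mk hli hspan.ge) fun j ↦ ?_
  have h1 := congrFun (Matrix.mulVec_cramer (G y) (k y)) j
  simp only [Matrix.mulVec, dotProduct, Pi.smul_apply, smul_eq_mul] at h1
  simp only [Module.Basis.coe_mk, sum_inner, Pi.smul_apply', inner_smul_left, c]
  change k y j = _
  rw [← mul_right_inj' hy, ← h1, Finset.mul_sum]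
  refine Finset.sum_congr rfl fun i _ ↦ ?_
  rw [conj_trivial, ← mul_assoc, mul_div_cancel₀ _ hy, mul_comm]
  rfl

theorem contMDiffAt_koszul {X Y Z : Π x : M, TangentSpace I x} {x : M}
    (hX : CMDiffAt ∞ (T% X) x) (hY : CMDiffAt ∞ (T% Y) x) (hZ : CMDiffAt ∞ (T% Z) x) :
    CMDiffAt ∞ (koszul X Y Z) x := by
  have h1 := contMDiffAt_mvfderiv (contMDiffAt_inner hY hZ) hX
  have h2 := contMDiffAt_mvfderiv (contMDiffAt_inner hZ hX) hY
  have h3 := contMDiffAt_mvfderiv (contMDiffAt_inner hX hY) hZ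
  have h4 := contMDiffAt_inner (contMDiffAt_mlieBracket hX hY) hZ
  have h5 := contMDiffAt_inner (contMDiffAt_mlieBracket hX hZ) hY
  have h6 := contMDiffAt_inner (contMDiffAt_mlieBracket hY hZ) hX
  exact contMDiffAt_const.mul (((((h1.add h2).sub h3).add h4).sub h5).sub h6)

theorem contMDiffAt_leviCivita {X Y : Π x : M, TangentSpace I x} {x : M}
    (hX : CMDiffAt ∞ (T% X) x) (hY : CMDiffAt ∞ (T% Y) x) :
    CMDiffAt ∞ (T% (fun y ↦ leviCivita I M Y y (X y))) x := by
  refine contMDiffAt_of_inner fun W hW ↦ (contMDiffAt_koszul hX hY hW).congr_of_eventuallyEq ?_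
  filter_upwards [eventually_mdifferentiableAt_section hX, eventually_mdifferentiableAt_section hY,
    eventually_mdifferentiableAt_section hW] with y h1 h2 h3
  exact inner_leviCivita h1 h2 h3

theorem leviCivita_congr {Y Y' : Π x : M, TangentSpace I x} {x : M}
    (hY : MDiffAt (T% Y) x) (hY' : MDiffAt (T% Y') x) (h : ∀ᶠ y in 𝓝 x, Y y = Y' y) :
    leviCivita I M Y x = leviCivita I M Y' x :=
  (leviCivita I M).isCovariantDerivativeOn.congr_of_eventuallyEq hY hY' univ_mem h

theorem leviCivita_add {Y Y' : Π x : M, TangentSpace I x} {x : M}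
    (hY : MDiffAt (T% Y) x) (hY' : MDiffAt (T% Y') x) :
    leviCivita I M (Y + Y') x = leviCivita I M Y x + leviCivita I M Y' x :=
  (leviCivita I M).isCovariantDerivativeOn.add hY hY'

theorem leviCivita_smul {f : M → ℝ} {Y : Π x : M, TangentSpace I x} {x : M}
    (hf : MDiffAt f x) (hY : MDiffAt (T% Y) x) (u : TangentSpace I x) :
    leviCivita I M (f • Y) x u = f x • leviCivita I M Y x u + d% f x u • Y x := by
  rw [(leviCivita I M).isCovariantDerivativeOn.leibniz hY hf]
  rfl

theorem leviCivita_neg {Y : Π x : M, TangentSpace I x} {x : M} (hY : MDiffAt (T% Y) x) :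
    leviCivita I M (-Y) x = -leviCivita I M Y x := by
  ext u
  have h := leviCivita_smul (f := fun _ : M ↦ (-1 : ℝ)) mdifferentiableAt_const hY u
  have h1 : ((fun _ : M ↦ (-1 : ℝ)) • Y) = -Y := by
    ext y
    simp
  rw [h1, mvfderiv_const] at h
  simpa using h

theorem leviCivita_sub_swap {X Y : Π x : M, TangentSpace I x} {x : M}
    (hX : MDiffAt (T% X) x) (hY : MDiffAt (T% Y) x) :
    leviCivita I M Y x (X x) - leviCivita I M X x (Y x) = mlieBracket I X Y x :=
  (leviCivita I M).torsion_eq_zero_iff.1 leviCivita_torsion hX hY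

/-- Second derivatives of `g(Z, W)` commute up to a bracket, so curvature is skew-adjoint. -/
theorem inner_curvature_skew {X Y Z W : Π x : M, TangentSpace I x} {x : M}
    (hX : CMDiffAt ∞ (T% X) x) (hY : CMDiffAt ∞ (T% Y) x) (hZ : CMDiffAt ∞ (T% Z) x)
    (hW : CMDiffAt ∞ (T% W) x) :
    (inner ℝ (curvature X Y Z x) (W x) : ℝ) = -inner ℝ (Z x) (curvature X Y W x) := by
  -- The two mixed products of first derivatives are exchanged when `X` and `Y` are, so they drop
  -- out of the commutator.
  have expand {X Y : Π x : M, TangentSpace I x} (hX : CMDiffAt ∞ (T% X) x)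
      (hY : CMDiffAt ∞ (T% Y) x) :
      d% (fun y ↦ d% (fun z ↦ (inner ℝ (Z z) (W z) : ℝ)) y (Y y)) x (X x)
        = (inner ℝ (leviCivita I M (fun y ↦ leviCivita I M Z y (Y y)) x (X x)) (W x)
          + inner ℝ (leviCivita I M Z x (Y x)) (leviCivita I M W x (X x)))
          + (inner ℝ (leviCivita I M Z x (X x)) (leviCivita I M W x (Y x))
          + inner ℝ (Z x) (leviCivita I M (fun y ↦ leviCivita I M W y (Y y)) x (X x))) := by
    have hYZ := contMDiffAt_leviCivita hY hZ
    have hYW := contMDiffAt_leviCivita hY hW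
    have hev : (fun y ↦ d% (fun z ↦ (inner ℝ (Z z) (W z) : ℝ)) y (Y y)) =ᶠ[𝓝 x]
        fun y ↦ inner ℝ (leviCivita I M Z y (Y y)) (W y)
          + inner ℝ (Z y) (leviCivita I M W y (Y y)) := by
      filter_upwards [eventually_mdifferentiableAt_section hY,
        eventually_mdifferentiableAt_section hZ, eventually_mdifferentiableAt_section hW]
        with y h1 h2 h3
      exact leviCivita_metric h1 h2 h3
    rw [mvfderiv_congr hev, mvfderiv_fun_add
      ((contMDiffAt_inner hYZ hW).mdifferentiableAt (by simp))
      ((contMDiffAt_inner hZ hYW).mdifferentiableAt (by simp)), add_apply,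
      leviCivita_metric (mdifferentiableAt_section hX) (mdifferentiableAt_section hYZ)
        (mdifferentiableAt_section hW),
      leviCivita_metric (mdifferentiableAt_section hX) (mdifferentiableAt_section hZ)
        (mdifferentiableAt_section hYW)]
  have hc := mvfderiv_commutator (contMDiffAt_inner hZ hW) hX hY
  rw [expand hX hY, expand hY hX,
    leviCivita_metric (mdifferentiableAt_section (contMDiffAt_mlieBracket hX hY))
      (mdifferentiableAt_section hZ) (mdifferentiableAt_section hW)] at hc
  simp only [curvature, inner_sub_left, inner_sub_right]
  linarith

/-- The nine terms of the cyclic sum regroup, by vanishing torsion, into the three double brackets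
of the Jacobi identity. -/
theorem curvature_bianchi {X Y Z : Π x : M, TangentSpace I x} {x : M}
    (hX : CMDiffAt ∞ (T% X) x) (hY : CMDiffAt ∞ (T% Y) x) (hZ : CMDiffAt ∞ (T% Z) x) :
    curvature X Y Z x + curvature Y Z X x + curvature Z X Y x = 0 := by
  have key {X Y Z : Π x : M, TangentSpace I x} (hX : CMDiffAt ∞ (T% X) x)
      (hY : CMDiffAt ∞ (T% Y) x) (hZ : CMDiffAt ∞ (T% Z) x) :
      leviCivita I M (fun y ↦ leviCivita I M Z y (Y y)) x (X x)
        - leviCivita I M (fun y ↦ leviCivita I M Y y (Z y)) x (X x)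
        - leviCivita I M X x (mlieBracket I Y Z x) = mlieBracket I X (mlieBracket I Y Z) x := by
    have hYZ := contMDiffAt_leviCivita hY hZ
    have hZY := contMDiffAt_leviCivita hZ hY
    have hB := contMDiffAt_mlieBracket hY hZ
    have h1 : leviCivita I M (mlieBracket I Y Z) x
        = leviCivita I M (fun y ↦ leviCivita I M Z y (Y y)) x
          - leviCivita I M (fun y ↦ leviCivita I M Y y (Z y)) x := by
      rw [eq_sub_iff_add_eq, ← leviCivita_add (mdifferentiableAt_section hB)
        (mdifferentiableAt_section hZY)]
      refine leviCivita_congr (mdifferentiableAt_section (hB.add_section hZY))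
        (mdifferentiableAt_section hYZ) ?_
      filter_upwards [eventually_mdifferentiableAt_section hY,
        eventually_mdifferentiableAt_section hZ] with y h1 h2
      simp [← leviCivita_sub_swap h1 h2]
    rw [← leviCivita_sub_swap (mdifferentiableAt_section hX) (mdifferentiableAt_section hB), h1]
    rfl
  have h1 := key hX hY hZ
  have h2 := key hY hZ hX
  have h3 := key hZ hX hY
  have hJ := jacobi_mlieBracket hX hY hZ
  rw [mlieBracket_swap_apply (V := mlieBracket I X Y), mlieBracket_swap (V := X) (W := Z)] at hJ
  have h4 : mlieBracket I Y (-mlieBracket I Z X) x = -mlieBracket I Y (mlieBracket I Z X) x := by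
    have := mlieBracket_const_smul_right (V := Y) (c := (-1 : ℝ))
      (mdifferentiableAt_section (contMDiffAt_mlieBracket hZ hX))
    simpa using this
  rw [h4, ← h1, ← h2, ← h3, ← sub_eq_zero] at hJ
  rw [← hJ]
  simp only [curvature]
  abel

/-- The curvature tensor may be computed with any smooth extension of its third argument. -/
theorem inner_curvatureTensor {Z : Π x : M, TangentSpace I x} {x : M}
    (hZ : CMDiffAt ∞ (T% Z) x) (u v w : TangentSpace I x) :
    (inner ℝ (curvatureTensor x u v (Z x)) w : ℝ)
      = inner ℝ (curvature (extend E u) (extend E v) Z x) w := by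
  have hU (u : TangentSpace I x) : CMDiffAt ∞ (T% (extend E u)) x := contMDiffAt_extend I E _
  have h1 := inner_curvature_skew (hU u) (hU v) (hU (Z x)) (hU w)
  have h2 := inner_curvature_skew (hU u) (hU v) hZ (hU w)
  simp only [extend_apply_self] at h1 h2
  rw [h2, ← h1]
  rfl

end Connection

/-! ### Traces over an orthonormal basis of one tangent space. -/

section LinearAlgebra

variable {V : Type*} [NormedAddCommGroup V] [InnerProductSpace ℝ V] {ι : Type*} [Fintype ι]

/-- Both sides are traces of `B` against the matrix of `φ`, which is skew in an orthonormal basis.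
-/
theorem sum_bilin_skew (b : OrthonormalBasis ι ℝ V) (φ : V →L[ℝ] V)
    (hφ : ∀ u v, (inner ℝ (φ u) v : ℝ) = -inner ℝ u (φ v)) (B : V →L[ℝ] V →L[ℝ] ℝ) :
    ∑ i, B (φ (b i)) (b i) = -∑ i, B (b i) (φ (b i)) := by
  have h (i) : φ (b i) = ∑ j, (inner ℝ (b j) (φ (b i)) : ℝ) • b j := (b.sum_repr' _).symm
  have h1 : ∑ i, B (φ (b i)) (b i) = ∑ i, ∑ j, (inner ℝ (b j) (φ (b i)) : ℝ) * B (b j) (b i) := by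
    refine Finset.sum_congr rfl fun i _ ↦ ?_
    conv_lhs => rw [h i]
    simp
  have h2 : ∑ i, B (b i) (φ (b i)) = ∑ i, ∑ j, (inner ℝ (b j) (φ (b i)) : ℝ) * B (b i) (b j) := by
    refine Finset.sum_congr rfl fun i _ ↦ ?_
    conv_lhs => rw [h i]
    simp
  rw [h1, h2, Finset.sum_comm, ← Finset.sum_neg_distrib]
  refine Finset.sum_congr rfl fun i _ ↦ ?_
  rw [← Finset.sum_neg_distrib]
  refine Finset.sum_congr rfl fun j _ ↦ ?_
  rw [real_inner_comm, hφ]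
  ring

/-- The divergence of the structure tensor of a `K`-contact structure, at the level of one tangent
space; `D` plays the role of `∇φ`. -/
theorem sum_inner_covDeriv_self (b : OrthonormalBasis ι ℝ V) (φ : V →L[ℝ] V)
    (D : V →L[ℝ] V →L[ℝ] V) (ξ : V) (hξ : (inner ℝ ξ ξ : ℝ) = 1)
    (hφ : ∀ u v, (inner ℝ (φ u) v : ℝ) = -inner ℝ u (φ v))
    (hφφ : ∀ v, φ (φ v) = -v + (inner ℝ v ξ : ℝ) • ξ) (hφξ : φ ξ = 0)
    (hD : ∀ u v w, (inner ℝ (D u v) w : ℝ) = -inner ℝ v (D u w))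
    (hDφ : ∀ u v, D u (φ v) + φ (D u v)
      = -((inner ℝ v (φ u) : ℝ) • ξ) - (inner ℝ v ξ : ℝ) • φ u)
    (hcyc : ∀ u v w, (inner ℝ (D u v) w + inner ℝ (D v w) u + inner ℝ (D w u) v : ℝ) = 0) (v : V) :
    ∑ i, (inner ℝ (D (b i) (b i)) v : ℝ) = (Fintype.card ι - 1) * inner ℝ v ξ := by
  have hskew (u) : (inner ℝ u (φ u) : ℝ) = 0 := by
    have := hφ u u
    rw [real_inner_comm] at this
    linarith
  -- The cyclic identity on `(eᵢ, φeᵢ, x)` is summed. By `sum_bilin_skew` its first two terms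
  -- contribute equally, and the third sums to `g(ξ, φx) = 0`.
  have hτ (x : V) : ∑ i, (inner ℝ (D (b i) (φ (b i))) x : ℝ) = 0 := by
    have hB := sum_bilin_skew b φ hφ
      ((ContinuousLinearMap.compL ℝ V V ℝ (innerSL ℝ x)).comp D)
    simp only [ContinuousLinearMap.comp_apply, ContinuousLinearMap.compL_apply,
      innerSL_apply_apply] at hB
    have hpt (i) : (inner ℝ x (D (b i) (φ (b i))) : ℝ) - inner ℝ x (D (φ (b i)) (b i))
        + inner ℝ ξ (b i) * inner ℝ (b i) (φ x) = 0 := by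
      have h1 := hcyc (b i) (φ (b i)) x
      have h2 := congrArg (fun w ↦ (inner ℝ w (b i) : ℝ)) (hDφ x (b i))
      simp only [inner_add_left, inner_sub_left, inner_neg_left, inner_smul_left,
        conj_trivial] at h2
      rw [hφ] at h2
      have h3 := hD x (φ (b i)) (b i)
      have h4 := hD (φ (b i)) x (b i)
      rw [real_inner_comm (b i) (φ x), real_inner_comm ξ (b i)] at h2
      rw [real_inner_comm (D x (b i)) (φ (b i))] at h3
      rw [real_inner_comm (D (b i) (φ (b i))) x]
      linarith
    have hs := Finset.sum_congr rfl fun i (_ : i ∈ Finset.univ) ↦ hpt i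
    rw [Finset.sum_add_distrib, Finset.sum_sub_distrib, hB, b.sum_inner_mul_inner,
      real_inner_comm, hφ, hφξ, inner_zero_right] at hs
    simp only [real_inner_comm x] at hs ⊢
    simp at hs
    linarith
  -- The relation `hDφ` at `(eᵢ, eᵢ)` moves `φ` out of `D`, so the divergence is orthogonal to the
  -- image of `φ`. Only its `ξ`-component remains.
  have hτφ (x : V) : ∑ i, (inner ℝ (D (b i) (b i)) (φ x) : ℝ) = 0 := by
    have hpt (i) : (inner ℝ (D (b i) (φ (b i))) x : ℝ) - inner ℝ (D (b i) (b i)) (φ x)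
        = inner ℝ ξ (b i) * inner ℝ (b i) (φ x) := by
      have h2 := congrArg (fun w ↦ (inner ℝ w x : ℝ)) (hDφ (b i) (b i))
      simp only [inner_add_left, inner_sub_left, inner_neg_left, inner_smul_left,
        conj_trivial, hskew, hφ (b i) x, hφ (D (b i) (b i)) x] at h2
      rw [real_inner_comm ξ (b i)] at h2
      linarith
    have hs := Finset.sum_congr rfl fun i (_ : i ∈ Finset.univ) ↦ hpt i
    rw [Finset.sum_sub_distrib, hτ, b.sum_inner_mul_inner, real_inner_comm, hφ, hφξ,
      inner_zero_right] at hs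
    linarith
  -- Applying `φ` to `hDφ u ξ` recovers `D u ξ`, because `φ² = -I` on vectors orthogonal to `ξ` and
  -- skewness makes `D u ξ` such a vector.
  have hDξ (u : V) : D u ξ = -u + (inner ℝ u ξ : ℝ) • ξ := by
    have h1 := congrArg φ (hDφ u ξ)
    have h2 : (inner ℝ (D u ξ) ξ : ℝ) = 0 := by
      have := hD u ξ ξ
      rw [real_inner_comm (D u ξ) ξ] at this
      linarith
    simp only [hφξ, map_zero, map_add, map_sub, map_neg, map_smul, hφφ, h2, hξ] at h1
    rw [← sub_eq_zero] at h1 ⊢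
    rw [← neg_eq_zero, ← h1]
    module
  have hτξ : ∑ i, (inner ℝ (D (b i) (b i)) ξ : ℝ) = Fintype.card ι - 1 := by
    have hpt (i) : (inner ℝ (D (b i) (b i)) ξ : ℝ) = 1 - inner ℝ ξ (b i) * inner ℝ (b i) ξ := by
      rw [hD, hDξ, inner_add_right, inner_neg_right, inner_smul_right, real_inner_self_eq_norm_sq,
        b.norm_eq_one, real_inner_comm ξ]
      ring
    simp only [hpt, Finset.sum_sub_distrib, b.sum_inner_mul_inner, hξ]
    simp
  have hv : v = (inner ℝ v ξ : ℝ) • ξ - φ (φ v) := by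
    rw [hφφ]
    abel
  conv_lhs => rw [hv]
  simp only [inner_sub_right, inner_smul_right, Finset.sum_sub_distrib, ← Finset.mul_sum, hτφ, hτξ]
  ring

end LinearAlgebra

/-! ### `K`-contact geometry: `∇ξ`, `∇φ` and the Ricci curvature in the Reeb direction. -/

section KContact

variable {E : Type*} [NormedAddCommGroup E] [NormedSpace ℝ E] [FiniteDimensional ℝ E]
  {H : Type*} [TopologicalSpace H] {I : ModelWithCorners ℝ E H}
  {M : Type*} [TopologicalSpace M] [ChartedSpace H M] [IsManifold I ∞ M]
  [RiemannianBundle (fun x : M ↦ TangentSpace I x)]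
  [IsContMDiffRiemannianBundle I ∞ E (fun x : M ↦ TangentSpace I x)]
  {φ : Π x : M, TangentSpace I x →L[ℝ] TangentSpace I x}
  {ξ : Π x : M, TangentSpace I x} {η : Π x : M, TangentSpace I x →L[ℝ] ℝ}

namespace IsContactMetric

theorem mdifferentiableAt_phi (h : IsContactMetric φ ξ η) {Y : Π x : M, TangentSpace I x} {x : M}
    (hY : MDiffAt (T% Y) x) : MDiffAt (T% (fun y ↦ φ y (Y y))) x :=
  MDifferentiableAt.clm_bundle_apply (F₁ := E) (F₂ := E) (E₁ := fun x : M ↦ TangentSpace I x)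
    (E₂ := fun x : M ↦ TangentSpace I x) (b := fun x : M ↦ x)
    ((h.smooth_phi x).mdifferentiableAt (by simp)) hY

theorem mdifferentiableAt_xi (h : IsContactMetric φ ξ η) (x : M) : MDiffAt (T% ξ) x :=
  mdifferentiableAt_section (h.smooth_xi x)

/-- This is the antisymmetry of `dη`. -/
theorem inner_phi (h : IsContactMetric φ ξ η) (x : M) (u v : TangentSpace I x) :
    (inner ℝ (φ x u) v : ℝ) = -inner ℝ u (φ x v) := by
  have hU := mdifferentiableAt_extend I E (V := fun x : M ↦ TangentSpace I x) u
  have hV := mdifferentiableAt_extend I E (V := fun x : M ↦ TangentSpace I x) v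
  have h1 := h.d_eta x _ _ hU hV
  have h2 := h.d_eta x _ _ hV hU
  simp only [extend_apply_self] at h1 h2
  rw [real_inner_comm, ← h1, ← h2, dOneForm, dOneForm,
    mlieBracket_swap_apply (V := extend E u), map_neg]
  ring

/-- The covariant derivative `(∇_u φ) v` of the structure tensor. -/
noncomputable def covDerivPhi (h : IsContactMetric φ ξ η) (x : M) :
    TangentSpace I x →L[ℝ] TangentSpace I x →L[ℝ] TangentSpace I x :=
  TensorialAt.mkHom₂ (I := I) (F := E) (F' := E) (V := fun x : M ↦ TangentSpace I x)
    (V' := fun x : M ↦ TangentSpace I x)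
    (fun X Y ↦ leviCivita I M (fun y ↦ φ y (Y y)) x (X x) - φ x (leviCivita I M Y x (X x))) x
    (fun Y _ ↦
      { smul := fun _ _ ↦ by simp [smul_sub]
        add := fun _ _ ↦ by simp; abel })
    (fun X _ ↦
      { smul := fun {f Y} hf hY ↦ by
          have h1 : (fun y ↦ φ y ((f • Y) y)) = f • fun y ↦ φ y (Y y) := by
            ext y
            simp
          -- The terms `df(X) φY` from the two summands cancel, which makes the expression tensorial
          -- in `Y`.
          rw [h1, leviCivita_smul hf (h.mdifferentiableAt_phi hY), leviCivita_smul hf hY]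
          simp only [map_add, map_smul]
          module
        add := fun {Y Y'} hY hY' ↦ by
          have h1 : (fun y ↦ φ y ((Y + Y') y)) = (fun y ↦ φ y (Y y)) + fun y ↦ φ y (Y' y) := by
            ext y
            simp
          rw [h1, leviCivita_add (h.mdifferentiableAt_phi hY) (h.mdifferentiableAt_phi hY'),
            leviCivita_add hY hY']
          simp only [add_apply, map_add]
          abel })

theorem covDerivPhi_apply (h : IsContactMetric φ ξ η) {X Y : Π x : M, TangentSpace I x} {x : M}
    (hX : MDiffAt (T% X) x) (hY : MDiffAt (T% Y) x) :
    h.covDerivPhi x (X x) (Y x)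
      = leviCivita I M (fun y ↦ φ y (Y y)) x (X x) - φ x (leviCivita I M Y x (X x)) :=
  TensorialAt.mkHom₂_apply _ _ hX hY

/-- Obtained by differentiating the skewness of `φ` with a metric connection. -/
theorem inner_covDerivPhi (h : IsContactMetric φ ξ η) (x : M) (u v w : TangentSpace I x) :
    (inner ℝ (h.covDerivPhi x u v) w : ℝ) = -inner ℝ v (h.covDerivPhi x u w) := by
  have hU (u : TangentSpace I x) :=
    mdifferentiableAt_extend I E (V := fun x : M ↦ TangentSpace I x) u
  have h1 := leviCivita_metric (hU u) (h.mdifferentiableAt_phi (hU v)) (hU w)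
  have h2 := leviCivita_metric (hU u) (hU v) (h.mdifferentiableAt_phi (hU w))
  have h3 : (fun y ↦ (inner ℝ (φ y (extend E v y)) (extend E w y) : ℝ))
      = -fun y ↦ (inner ℝ (extend E v y) (φ y (extend E w y)) : ℝ) :=
    funext fun y ↦ h.inner_phi y _ _
  rw [h3, mvfderiv_neg, neg_apply, h2] at h1
  have h4 := h.covDerivPhi_apply (hU u) (hU v)
  have h5 := h.covDerivPhi_apply (hU u) (hU w)
  simp only [extend_apply_self] at h1 h4 h5
  rw [h4, h5, inner_sub_left, inner_sub_right, h.inner_phi x _ w]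
  rw [h.inner_phi x v _] at h1
  linarith

end IsContactMetric

namespace IsKContact

/-- The bilinear form `g(∇_u ξ, w)` has zero symmetric part by the Killing equation, and its skew
part is `dη(u, w) = g(u, φw)`. -/
theorem leviCivita_xi (h : IsKContact φ ξ η) (x : M) (u : TangentSpace I x) :
    leviCivita I M ξ x u = -φ x u := by
  refine ext_inner_right ℝ fun w ↦ ?_
  have hU (u : TangentSpace I x) :=
    mdifferentiableAt_extend I E (V := fun x : M ↦ TangentSpace I x) u
  have hξ := h.mdifferentiableAt_xi x
  have h1 := h.killing.lieDerivMetric_eq_zero x _ _ (hU u) (hU w)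
  rw [lieDerivMetric, leviCivita_metric hξ (hU u) (hU w), ← leviCivita_sub_swap hξ (hU u),
    ← leviCivita_sub_swap hξ (hU w)] at h1
  have h2 := h.d_eta x _ _ (hU u) (hU w)
  have h3 (v : TangentSpace I x) : (fun y ↦ η y (extend E v y))
      = fun y ↦ (inner ℝ (extend E v y) (ξ y) : ℝ) := funext fun y ↦ h.eta_eq y _
  rw [dOneForm, h3, h3, leviCivita_metric (hU u) (hU w) hξ, leviCivita_metric (hU w) (hU u) hξ,
    h.eta_eq, ← leviCivita_sub_swap (hU u) (hU w)] at h2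
  simp only [extend_apply_self, inner_sub_left, inner_sub_right] at h1 h2
  rw [inner_neg_left, h.inner_phi, ← h2, real_inner_comm (leviCivita I M ξ x u) w]
  linarith

/-- Differentiating `g(ξ, ξ) = 1` along `w` gives `g(φw, ξ) = 0`. -/
theorem phi_xi (h : IsKContact φ ξ η) (x : M) : φ x (ξ x) = 0 := by
  refine ext_inner_right ℝ fun w ↦ ?_
  have hW := mdifferentiableAt_extend I E (V := fun x : M ↦ TangentSpace I x) w
  have h1 := leviCivita_metric hW (h.mdifferentiableAt_xi x) (h.mdifferentiableAt_xi x)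
  rw [funext h.inner_xi, mvfderiv_const, h.leviCivita_xi, extend_apply_self,
    real_inner_comm (-φ x w) (ξ x), inner_neg_left, h.inner_phi,
    real_inner_comm (φ x (ξ x)) w] at h1
  rw [inner_zero_left]
  simp only [zero_apply] at h1
  linarith

/-- The covariant derivative of `φ² = -I + η ⊗ ξ`, with `∇ξ = -φ` inserted on the right. -/
theorem covDerivPhi_phi (h : IsKContact φ ξ η) (x : M) (u v : TangentSpace I x) :
    h.covDerivPhi x u (φ x v) + φ x (h.covDerivPhi x u v)
      = -((inner ℝ v (φ x u) : ℝ) • ξ x) - (inner ℝ v (ξ x) : ℝ) • φ x u := by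
  have hU := mdifferentiableAt_extend I E (V := fun x : M ↦ TangentSpace I x) u
  have hV := mdifferentiableAt_extend I E (V := fun x : M ↦ TangentSpace I x) v
  have hξ := h.mdifferentiableAt_xi x
  have h1 := h.covDerivPhi_apply hU hV
  have h2 := h.covDerivPhi_apply hU (h.mdifferentiableAt_phi hV)
  have h3 : (fun y ↦ φ y (φ y (extend E v y)))
      = -extend E v + (fun y ↦ (inner ℝ (extend E v y) (ξ y) : ℝ)) • ξ := by
    ext y
    simp [h.phi_phi, h.eta_eq]
  have h4 := mdifferentiableAt_inner hV hξ
  have h5 : MDiffAt (T% (-extend E v : Π y : M, TangentSpace I y)) x :=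
    mdifferentiableAt_neg_section hV
  have h6 := leviCivita_metric hU hV hξ
  rw [h3, leviCivita_add h5 (h4.smul_section hξ), leviCivita_neg hV, add_apply,
    leviCivita_smul h4 hξ, h6] at h2
  simp only [extend_apply_self, neg_apply] at h1 h2
  rw [h1, h2, map_sub, h.phi_phi, h.eta_eq, h.leviCivita_xi]
  simp only [inner_neg_right]
  module

/-- `R(X, Y)ξ = (∇_Y φ) X - (∇_X φ) Y`. -/
theorem curvature_xi (h : IsKContact φ ξ η) {X Y : Π x : M, TangentSpace I x} {x : M}
    (hX : CMDiffAt ∞ (T% X) x) (hY : CMDiffAt ∞ (T% Y) x) :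
    curvature X Y ξ x = h.covDerivPhi x (Y x) (X x) - h.covDerivPhi x (X x) (Y x) := by
  have hX' := mdifferentiableAt_section hX
  have hY' := mdifferentiableAt_section hY
  have key {Y : Π x : M, TangentSpace I x} (hY : MDiffAt (T% Y) x) :
      leviCivita I M (fun y ↦ leviCivita I M ξ y (Y y)) x
        = -leviCivita I M (fun y ↦ φ y (Y y)) x := by
    rw [← leviCivita_neg (h.mdifferentiableAt_phi hY)]
    congr 1
    ext y
    exact h.leviCivita_xi y _
  rw [curvature, key hX', key hY', h.leviCivita_xi, ← leviCivita_sub_swap hX' hY',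
    h.covDerivPhi_apply hX' hY', h.covDerivPhi_apply hY' hX', map_sub]
  simp only [neg_apply]
  abel

theorem inner_curvatureTensor_xi (h : IsKContact φ ξ η) (x : M) (u v w : TangentSpace I x) :
    (inner ℝ (curvatureTensor x u v (ξ x)) w : ℝ)
      = inner ℝ (h.covDerivPhi x v u) w - inner ℝ (h.covDerivPhi x u v) w := by
  rw [inner_curvatureTensor (h.smooth_xi x), h.curvature_xi (contMDiffAt_extend I E _)
    (contMDiffAt_extend I E _), inner_sub_left]
  simp

/-- Equivalent to closedness of the fundamental form `dη`. It is read off from the `ξ`-component of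
the first Bianchi identity, where each cyclic term appears twice. -/
theorem inner_covDerivPhi_cyclic (h : IsKContact φ ξ η) (x : M) (u v w : TangentSpace I x) :
    (inner ℝ (h.covDerivPhi x u v) w + inner ℝ (h.covDerivPhi x v w) u
      + inner ℝ (h.covDerivPhi x w u) v : ℝ) = 0 := by
  have hU (u : TangentSpace I x) : CMDiffAt ∞ (T% (extend E u)) x := contMDiffAt_extend I E _
  have key (u v w : TangentSpace I x) :
      (inner ℝ (curvature (extend E u) (extend E v) (extend E w) x) (ξ x) : ℝ)
        = inner ℝ (h.covDerivPhi x u v) w + inner ℝ (h.covDerivPhi x v w) u := by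
    rw [inner_curvature_skew (hU u) (hU v) (hU w) (h.smooth_xi x), h.curvature_xi (hU u) (hU v)]
    simp only [extend_apply_self, inner_sub_right]
    have h1 := h.inner_covDerivPhi x v w u
    have h2 := real_inner_comm w (h.covDerivPhi x u v)
    linarith
  have hB := congrArg (fun z ↦ (inner ℝ z (ξ x) : ℝ)) (curvature_bianchi (hU u) (hU v) (hU w))
  simp only [inner_add_left, key, inner_zero_left] at hB
  linarith

/-- On a `K`-contact manifold `Ric(v, ξ) = (dim M - 1) η(v)`. -/
theorem ricci_xi (h : IsKContact φ ξ η) (x : M) (v : TangentSpace I x) :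
    ricci x v (ξ x) = ((Module.finrank ℝ E : ℝ) - 1) * inner ℝ v (ξ x) := by
  have hs := sum_inner_covDeriv_self (stdOrthonormalBasis ℝ (TangentSpace I x)) (φ x)
    (h.covDerivPhi x) (ξ x) (h.inner_xi x) (h.inner_phi x)
    (fun v ↦ by rw [h.phi_phi, h.eta_eq]) (h.phi_xi x) (h.inner_covDerivPhi x)
    (h.covDerivPhi_phi x) (h.inner_covDerivPhi_cyclic x) v
  rw [Fintype.card_fin] at hs
  refine Eq.trans (Finset.sum_congr rfl fun i _ ↦ ?_) hs
  rw [h.inner_curvatureTensor_xi]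
  -- Skewness kills `g((∇_v φ)eᵢ, eᵢ)`, so only the divergence of `φ` contributes to the trace.
  have h1 := h.inner_covDerivPhi x v (stdOrthonormalBasis ℝ (TangentSpace I x) i)
    (stdOrthonormalBasis ℝ (TangentSpace I x) i)
  rw [real_inner_comm (h.covDerivPhi x v (stdOrthonormalBasis ℝ (TangentSpace I x) i))] at h1
  rw [h.inner_covDerivPhi x _ v, real_inner_comm v]
  linarith

end IsKContact

end KContact

/-- Without boundary the chart target is open, so it contains a ball around the image of each point,
and a function with zero derivative is constant on that ball. -/
theorem isLocallyConstant_of_mvfderiv_eq_zero {E : Type*} [NormedAddCommGroup E]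
    [NormedSpace ℝ E] {H : Type*} [TopologicalSpace H] {I : ModelWithCorners ℝ E H}
    [I.Boundaryless] {M : Type*} [TopologicalSpace M] [ChartedSpace H M] [IsManifold I ∞ M]
    {f : M → ℝ} (hf : MDiff f) (hf' : ∀ x : M, (d% f x : TangentSpace I x →L[ℝ] ℝ) = 0) :
    IsLocallyConstant f := by
  refine (IsLocallyConstant.iff_eventually_eq f).2 fun x ↦ ?_
  let e := extChartAt I x
  have hopen : IsOpen e.target := isOpen_extChartAt_target x
  have hd (y) (hy : y ∈ e.target) : HasFDerivAt (f ∘ e.symm) (0 : E →L[ℝ] ℝ) y := by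
    have h1 : HasMFDerivAt I 𝓘(ℝ, ℝ) f (e.symm y) 0 := by
      have h0 := (hf (e.symm y)).hasMFDerivAt
      have h2 : mfderiv% f (e.symm y) = 0 := by
        ext v
        exact congrArg (fun L : TangentSpace I (e.symm y) →L[ℝ] ℝ ↦ L v) (hf' (e.symm y))
      rwa [h2] at h0
    have h3 : MDifferentiableAt 𝓘(ℝ, E) I e.symm y :=
      ((contMDiffOn_extChartAt_symm (n := ∞) x).contMDiffAt
        (hopen.mem_nhds hy)).mdifferentiableAt (by simp)
    have h4 := h1.comp y h3.hasMFDerivAt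
    rw [hasMFDerivAt_iff_hasFDerivAt] at h4
    exact h4.congr_fderiv (ContinuousLinearMap.zero_comp _)
  obtain ⟨r, hr, hball⟩ := Metric.isOpen_iff.1 hopen _ (mem_extChartAt_target x)
  have hx : e x ∈ Metric.ball (e x) r := Metric.mem_ball_self hr
  filter_upwards [(continuousAt_extChartAt (I := I) x).preimage_mem_nhds
    (Metric.ball_mem_nhds _ hr), extChartAt_source_mem_nhds (I := I) x] with z hz hzs
  have h := Metric.isOpen_ball.is_const_of_fderiv_eq_zero (𝕜 := ℝ) (f := f ∘ e.symm)
    (convex_ball (e x) r).isPreconnected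
    (fun y hy ↦ (hd y (hball hy)).differentiableAt.differentiableWithinAt)
    (fun y hy ↦ (hd y (hball hy)).fderiv) hz hx
  rwa [Function.comp_apply, Function.comp_apply, e.left_inv hzs,
    e.left_inv (mem_extChartAt_source x)] at h

/-! ### Quasi-Einstein structures with potential `σξ`. -/

section KContact

variable {E : Type*} [NormedAddCommGroup E] [NormedSpace ℝ E] [FiniteDimensional ℝ E]
  {H : Type*} [TopologicalSpace H] {I : ModelWithCorners ℝ E H}
  {M : Type*} [TopologicalSpace M] [ChartedSpace H M] [IsManifold I ∞ M]
  [RiemannianBundle (fun x : M ↦ TangentSpace I x)]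
  [IsContMDiffRiemannianBundle I ∞ E (fun x : M ↦ TangentSpace I x)]
  {φ : Π x : M, TangentSpace I x →L[ℝ] TangentSpace I x}
  {ξ : Π x : M, TangentSpace I x} {η : Π x : M, TangentSpace I x →L[ℝ] ℝ}

/-- By the Leibniz rule the only other term is `σ 𝓛_ξ g`, which vanishes. -/
theorem IsKilling.lieDerivMetric_smul (hξ : IsKilling ξ) {σ : M → ℝ}
    {X Y : Π x : M, TangentSpace I x} {x : M} (hσ : MDiffAt σ x) (hX : MDiffAt (T% X) x)
    (hY : MDiffAt (T% Y) x) :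
    lieDerivMetric (σ • ξ) X Y x
      = d% σ x (X x) * inner ℝ (ξ x) (Y x) + d% σ x (Y x) * inner ℝ (X x) (ξ x) := by
  have h1 := hξ.lieDerivMetric_eq_zero x X Y hX hY
  have h2 := mdifferentiableAt_section (hξ.smooth x)
  rw [lieDerivMetric] at h1 ⊢
  rw [mlieBracket_smul_left hσ h2, mlieBracket_smul_left hσ h2]
  simp only [Pi.smul_apply', map_smul, smul_eq_mul, inner_add_left, inner_add_right,
    inner_smul_left, inner_smul_right, conj_trivial, neg_smul, inner_neg_left, inner_neg_right]
  linear_combination σ x * h1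

/-- A function whose gradient is collinear to the Reeb field is locally constant, because the
contact distribution is nowhere integrable. -/
theorem IsContactMetric.mvfderiv_eq_zero_of_collinear (h : IsContactMetric φ ξ η)
    (hE : 1 < Module.finrank ℝ E) {σ : M → ℝ} (hσ : CMDiff ∞ σ)
    (hgrad : ∀ (x : M) (u : TangentSpace I x), d% σ x u = d% σ x (ξ x) * inner ℝ u (ξ x))
    (x : M) : (d% σ x : TangentSpace I x →L[ℝ] ℝ) = 0 := by
  -- If `ξ x` had zero orthogonal complement it would span the tangent space, against `1 < dim`.
  obtain ⟨u, hu, hu0⟩ : ∃ u : TangentSpace I x, (inner ℝ u (ξ x) : ℝ) = 0 ∧ u ≠ 0 := by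
    by_contra! hcon
    have h1 : Module.finrank ℝ (TangentSpace I x) ≤ 1 := finrank_le_one (ξ x) fun w ↦
      ⟨inner ℝ w (ξ x), (sub_eq_zero.1 (hcon (w - (inner ℝ w (ξ x) : ℝ) • ξ x) (by
        rw [inner_sub_left, inner_smul_left, h.inner_xi]
        simp))).symm⟩
    exact absurd h1 (not_le.2 hE)
  have hU (u : TangentSpace I x) : CMDiffAt ∞ (T% (extend E u)) x := contMDiffAt_extend I E _
  -- Computing `φ³u` in two ways yields `η(φu) ξ = 0`; no Killing condition enters.
  have hφu : (inner ℝ (φ x u) (ξ x) : ℝ) = 0 := by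
    have h1 := h.phi_phi x (φ x u)
    rw [h.phi_phi x u, h.eta_eq, hu, zero_smul, add_zero, map_neg, h.eta_eq] at h1
    have h2 := congrArg (fun w ↦ (inner ℝ w (ξ x) : ℝ)) (left_eq_add.1 h1)
    rwa [inner_smul_left, h.inner_xi, mul_one, inner_zero_left] at h2
  have hf := contMDiffAt_mvfderiv (hσ x) (h.smooth_xi x)
  have hfx := hf.mdifferentiableAt (by simp)
  have hη (v : TangentSpace I x) :=
    (contMDiffAt_inner (hU v) (h.smooth_xi x)).mdifferentiableAt (by simp)
  have hc := mvfderiv_commutator (hσ x) (hU u) (hU (φ x u))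
  have hd := h.d_eta x _ _ (mdifferentiableAt_section (hU u))
    (mdifferentiableAt_section (hU (φ x u)))
  have hη' (v : TangentSpace I x) : (fun y ↦ η y (extend E v y))
      = fun y ↦ (inner ℝ (extend E v y) (ξ y) : ℝ) := funext fun y ↦ h.eta_eq y _
  rw [dOneForm, hη', hη', h.eta_eq] at hd
  simp only [hgrad _ (extend E _ _), hgrad _ (mlieBracket I _ _ _)] at hc
  rw [mvfderiv_fun_mul hfx (hη _), mvfderiv_fun_mul hfx (hη _)] at hc
  simp only [extend_apply_self, smul_apply, hu, hφu, zero_smul, add_zero,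
    smul_eq_mul, h.phi_phi, h.eta_eq, inner_neg_right] at hc hd
  -- Derivatives of `ξσ` are multiplied by `η(u)` or `η(φu)`, both zero. What is left of the
  -- commutator is `2 (ξσ) dη(u, φu) = 0`, with `dη(u, φu) = g(u, φ²u) = -g(u, u)`.
  have h0 : d% σ x (ξ x) * (inner ℝ u u : ℝ) = 0 := by
    linear_combination d% σ x (ξ x) * hd - hc / 2
  have hne : (inner ℝ u u : ℝ) ≠ 0 := fun h1 ↦ hu0 (inner_self_eq_zero.1 h1)
  ext w
  rw [hgrad, (mul_eq_zero.1 h0).resolve_right hne, zero_mul]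
  rfl

/-- A quasi-Einstein structure on a `K`-contact manifold whose potential is collinear to the Reeb
field has a Killing potential of locally constant length, and the manifold is `η`-Einstein. -/
theorem IsKContact.isKilling_of_isQuasiEinstein [I.Boundaryless] (hM : IsKContact φ ξ η)
    (hE : 1 < Module.finrank ℝ E) {m : ℝ≥0∞} {ρ : ℝ} {V : Π x : M, TangentSpace I x}
    (hV : IsQuasiEinstein m ρ V) {σ : M → ℝ} (hσ : CMDiff ∞ σ) (hVσ : ∀ x : M, V x = σ x • ξ x) :
    IsKilling V ∧ IsEtaEinstein η ∧ IsLocallyConstant σ := by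
  obtain rfl : V = σ • ξ := funext hVσ
  have hσd : MDiff σ := hσ.mdifferentiable (by simp)
  obtain ⟨lam, heq⟩ := hV.equation
  have hξξ (x : M) : (inner ℝ (ξ x) (ξ x) : ℝ) = 1 := hM.inner_xi x
  have hU {x : M} (u : TangentSpace I x) :=
    mdifferentiableAt_extend I E
      (V := fun x : M ↦ TangentSpace I x) u
  have heqξ (x : M) (u : TangentSpace I x) :
      (1 / 2 : ℝ) * (d% σ x u + d% σ x (ξ x) * inner ℝ u (ξ x))
          + ((Module.finrank ℝ E : ℝ) - 1) * inner ℝ u (ξ x)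
          - (m⁻¹).toReal * (σ x ^ 2 * inner ℝ u (ξ x))
        = (lam + ρ * scalarCurvature I x) * inner ℝ u (ξ x) := by
    have h := heq x _ ξ (hU u) (hM.mdifferentiableAt_xi x)
    rw [hM.killing.lieDerivMetric_smul (hσd x) (hU u) (hM.mdifferentiableAt_xi x),
      hM.ricci_xi] at h
    simp only [extend_apply_self, Pi.smul_apply', inner_smul_left, conj_trivial, hξξ,
      real_inner_comm u (ξ x)] at h
    linear_combination h
  have hdσ (x : M) : (d% σ x : TangentSpace I x →L[ℝ] ℝ) = 0 := by
    refine hM.mvfderiv_eq_zero_of_collinear hE hσ (fun x u ↦ ?_) x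
    have h1 := heqξ x u
    -- The value at `ξ` determines the coefficient of `η`; eliminating it leaves `dσ(u) = (ξσ)
    -- η(u)`.
    have h2 := heqξ x (ξ x)
    rw [hξξ] at h2
    linear_combination 2 * h1 - 2 * inner ℝ u (ξ x) * h2
  have hconst : IsLocallyConstant σ :=
    isLocallyConstant_of_mvfderiv_eq_zero hσd hdσ
  have hlie (x : M) (X Y : Π x : M, TangentSpace I x) (hX : MDiffAt (T% X) x)
      (hY : MDiffAt (T% Y) x) : lieDerivMetric (σ • ξ) X Y x = 0 := by
    rw [hM.killing.lieDerivMetric_smul (hσd x) hX hY, hdσ]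
    simp
  refine ⟨⟨hV.smooth, hlie⟩, ?_, hconst⟩
  have hsq : CMDiff ∞ (fun x ↦ (m⁻¹).toReal * σ x ^ 2) := contMDiff_const.mul (hσ.pow 2)
  -- With `dσ = 0`, the equation on `(ξ, ξ)` reads `lam + ρ r = dim M - 1 - σ²/m`. Using the right
  -- side as `a` makes smoothness evident without any regularity of `r`.
  refine ⟨fun x ↦ (Module.finrank ℝ E : ℝ) - 1 - (m⁻¹).toReal * σ x ^ 2,
    fun x ↦ (m⁻¹).toReal * σ x ^ 2, contMDiff_const.sub hsq, hsq, fun x v w ↦ ?_⟩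
  have h1 := heq x _ _ (hU v) (hU w)
  have h2 := heqξ x (ξ x)
  rw [hlie x _ _ (hU v) (hU w)] at h1
  rw [hdσ, hξξ] at h2
  simp only [extend_apply_self, Pi.smul_apply', inner_smul_left, conj_trivial, zero_apply] at h1 h2
  rw [hM.eta_eq, hM.eta_eq, real_inner_comm (ξ x) v, real_inner_comm (ξ x) w]
  linear_combination h1 - inner ℝ v w * h2

end KContact

end QuasiEinstein

theorem mainTheorem8 {n : ℕ} (hn : 1 ≤ n)
    {M : Type*} [TopologicalSpace M] [ChartedSpace (EuclideanSpace ℝ (Fin (2 * n + 1))) M]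
    [IsManifold (𝓡 (2 * n + 1)) ∞ M]
    [RiemannianBundle (fun x : M ↦ TangentSpace (𝓡 (2 * n + 1)) x)]
    [IsContMDiffRiemannianBundle (𝓡 (2 * n + 1)) ∞ (EuclideanSpace ℝ (Fin (2 * n + 1)))
      (fun x : M ↦ TangentSpace (𝓡 (2 * n + 1)) x)]
    (φ : Π x : M, TangentSpace (𝓡 (2 * n + 1)) x →L[ℝ] TangentSpace (𝓡 (2 * n + 1)) x)
    (ξ : Π x : M, TangentSpace (𝓡 (2 * n + 1)) x)
    (η : Π x : M, TangentSpace (𝓡 (2 * n + 1)) x →L[ℝ] ℝ)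
    (hM : QuasiEinstein.IsKContact φ ξ η)
    (m : ℝ≥0∞) (ρ : ℝ) (V : Π x : M, TangentSpace (𝓡 (2 * n + 1)) x)
    (hV : QuasiEinstein.IsQuasiEinstein m ρ V)
    (σ : M → ℝ) (hσ : ContMDiff (𝓡 (2 * n + 1)) 𝓘(ℝ) ∞ σ) (hVσ : ∀ x : M, V x = σ x • ξ x) :
    QuasiEinstein.IsKilling V ∧ QuasiEinstein.IsEtaEinstein η ∧ IsLocallyConstant σ ∧
      (PreconnectedSpace M → ∃ c : ℝ, ∀ x : M, σ x = c) := by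
  obtain ⟨h1, h2, h3⟩ := hM.isKilling_of_isQuasiEinstein
    -- Here `n ≥ 1` provides a direction orthogonal to `ξ`.
    (by rw [finrank_euclideanSpace_fin]; omega) hV hσ hVσ
  exact ⟨h1, h2, h3, fun _ ↦ h3.exists_eq_const.imp fun _ h ↦ congrFun h⟩
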